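/- Let $p\ge 3$ be a prime. For $k\ge 0$, let row $k$ be the finite string of coefficients (ordered by powers of $x$, from degree $0$ to degree $k$) of $(1+x)^k$ reduced modulo $p$. For $m\ge 0$, an $m$-block is a string of $m$ digits modulo $p$, and it is called accessible if it occurs as a block of consecutive entries of row $k$ for some $k\ge 0$. Let $a_{1+x,p}(m)$ be the number of accessible $m$-blocks (so $a_{1+x,p}(0)=1$, counting the empty block). Then, as formal power series with rational coefficients, $$\sum_{n\ge 0}a_{1+x,p}(n)z^n=\frac{1}{(1-z)^3}\left(1+(p-3)z+(p^2-3p+3)z^2+z^2\,\frac{(p-1)^2}{2}\sum_{i\ge 0}\Big(p\,z^{p^i}-2(p-1)z^{2p^i}+(p-2)z^{3p^i}\Big)\right),$$ where the sum over $i$ converges coefficientwise. -/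

import Mathlib

open scoped PowerSeries.WithPiTopology

/-- Row `k` for `f` and `p` is the string of coefficients, in order of the powers of `x`, of `f ^ k`
reduced modulo `p`. An `m`-block `b` (a string of `m` digits modulo `p`) is accessible if it is a
substring of some row: the digits of `b` are the coefficients of `x ^ j, …, x ^ (j + m - 1)` in
some `f ^ k`, and this window does not run past the last entry of the row. -/
def IsAccessibleBlock (f : Polynomial ℤ) (p m : ℕ) (b : Fin m → ZMod p) : Prop :=
  ∃ k j : ℕ, j + m ≤ ((f.map (Int.castRingHom (ZMod p))) ^ k).natDegree + 1 ∧
    ∀ i : Fin m, b i = ((f.map (Int.castRingHom (ZMod p))) ^ k).coeff (j + i)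

/-- The number `a_{f,p}(m)` of accessible `m`-blocks, for a prime `p`.
For `m = 0` only the empty block is counted, so that the value is `1`. -/
noncomputable def accessibleCount (f : Polynomial ℤ) (p m : ℕ) : ℕ :=
  {b : Fin m → ZMod p | IsAccessibleBlock f p m b}.ncard

/-- The generating function `∑ a_{f,p}(n) z ^ n`, as a formal power series. -/
noncomputable def accessibleGenFun (f : Polynomial ℤ) (p : ℕ) : PowerSeries ℚ :=
  PowerSeries.mk fun n => (accessibleCount f p n : ℚ)

/-- The `i`-th summand `p z ^ (p ^ i) - 2 (p - 1) z ^ (2 p ^ i) + (p - 2) z ^ (3 p ^ i)`. -/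
noncomputable def lacunaryTerm (p i : ℕ) : PowerSeries ℚ :=
  PowerSeries.C (p : ℚ) * PowerSeries.X ^ (p ^ i)
    - PowerSeries.C (2 * ((p : ℚ) - 1)) * PowerSeries.X ^ (2 * p ^ i)
    + PowerSeries.C ((p : ℚ) - 2) * PowerSeries.X ^ (3 * p ^ i)

/-!
Pad the rows of Pascal's triangle modulo `p` by zeros on both sides. By Lucas' theorem a multiple of
any row, surrounded by long strings of zeros, reappears inside a later row, so the accessible blocks
are exactly the windows of padded rows (`isAccessibleBlock_iff`). They are sorted here by the residues
`r`, `s` modulo `p` of the row and of the starting column (`residueBlocks`).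

For given residues Lucas' theorem writes such a block as the blow-up of an accessible block of about
`m / p` digits, precisely `⌊(m + r + d) / p⌋` digits with `d ≡ s - r - 1` and `0 ≤ r, d < p`, and
blowing up is injective (`ncard_residueBlocks`).

On the other hand the identity `(1 + x) y' = k y` for `y = (1 + x) ^ k` gives, for any two adjacent
digits of a block `b`, the equation `(b i + b (i + 1)) * (s + i + 1) = b i * (r + 1)`. These linear
equations in `r` and `s` have at most one solution when `m ≥ 3`, unless `b` is zero or of one of the
forms `0, …, 0, c`, `c, 0, …, 0`, and `c, -c, c, …` (`residues_unique`). The zero block occurs with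
all `p ^ 2` pairs of residues, and each of the `3 (p - 1)` other exceptional blocks with `p` of them.
Hence (`sum_accessibleCount_div`), for `m ≥ 3`,
`∑_{r, d < p} a ⌊(m + r + d) / p⌋ = a m + 3 (p - 1) ^ 2 + (p ^ 2 - 1)`.

Second differences of the left-hand side telescope, so the second difference `D` of `a` satisfies
`D m = D ⌊m / p⌋` for `m ≥ 3`. The difference of `D` therefore vanishes away from `p ^ i`, `2 p ^ i`,
`3 p ^ i`, and its values there follow from `a 0 = 1`, `a 1 = p`, `a 2 = p ^ 2`
(`secondDiff_succ_sub`). This is the asserted value of `(1 - z) ^ 3 ∑ a n z ^ n`.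
-/

/-! ### Pascal's triangle modulo a prime -/

/-- The entry of Pascal's triangle modulo `p` in row `k` and column `j`, for an integer `j`: the row
is continued by zeros on both sides. -/
def paddedChoose (p k : ℕ) (j : ℤ) : ZMod p :=
  if 0 ≤ j then (k.choose j.toNat : ZMod p) else 0

@[simp] lemma paddedChoose_natCast (p k j : ℕ) :
    paddedChoose p k (j : ℤ) = (k.choose j : ZMod p) := by
  simp [paddedChoose]

lemma paddedChoose_of_neg {p k : ℕ} {j : ℤ} (hj : j < 0) : paddedChoose p k j = 0 := by
  simp [paddedChoose, hj]

/-- The coefficient form of the differential equation `(1 + x) y' = k y` of `y = (1 + x) ^ k`. -/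
lemma paddedChoose_add_succ_mul (p k : ℕ) (j : ℤ) :
    (paddedChoose p k j + paddedChoose p k (j + 1)) * ((j : ZMod p) + 1)
      = paddedChoose p k j * ((k : ZMod p) + 1) := by
  rcases lt_or_ge j 0 with hj | hj
  · rw [paddedChoose_of_neg hj]
    rcases (show j + 1 < 0 ∨ j = -1 by omega) with h | h
    · rw [paddedChoose_of_neg h]; simp
    · subst h; simp
  · lift j to ℕ using hj
    have h : ((j : ℤ) + 1) = ((j + 1 : ℕ) : ℤ) := by push_cast; rfl
    have e := congrArg (Nat.cast : ℕ → ZMod p) (Nat.add_one_mul_choose_eq k j)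
    rw [Nat.choose_succ_succ] at e
    rw [h, paddedChoose_natCast, paddedChoose_natCast]
    push_cast at e ⊢
    linear_combination -e

section Prime

variable {p : ℕ} [hp : Fact p.Prime]

/-- Lucas' congruence for the padded triangle. -/
lemma paddedChoose_lucas (k : ℕ) {r s : ℕ} (hr : r < p) (hs : s < p) (j : ℤ) :
    paddedChoose p (p * k + r) (p * j + s) = paddedChoose p k j * (r.choose s : ZMod p) := by
  have hp0 : 0 < p := hp.out.pos
  rcases lt_or_ge j 0 with hj | hj
  · have : (p : ℤ) * j + s < 0 := by nlinarith
    rw [paddedChoose_of_neg hj, paddedChoose_of_neg this, zero_mul]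
  · lift j to ℕ using hj
    rw [show (p : ℤ) * j + s = ((p * j + s : ℕ) : ℤ) by push_cast; rfl, paddedChoose_natCast,
      paddedChoose_natCast]
    have h := Choose.choose_modEq_choose_mod_mul_choose_div_nat (p := p) (n := p * k + r)
      (k := p * j + s)
    rw [← ZMod.natCast_eq_natCast_iff] at h
    rw [h, Nat.mul_add_mod, Nat.mul_add_mod, Nat.mod_eq_of_lt hr, Nat.mod_eq_of_lt hs,
      Nat.mul_add_div hp0, Nat.mul_add_div hp0, Nat.div_eq_of_lt hr, Nat.div_eq_of_lt hs]
    push_cast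
    simp [mul_comm]

lemma paddedChoose_lucas_pow (N K : ℕ) (q : ℤ) :
    ∀ {k e : ℕ}, k < p ^ N → e < p ^ N →
      paddedChoose p (p ^ N * K + k) (p ^ N * q + e)
        = paddedChoose p K q * (k.choose e : ZMod p) := by
  have hp0 : 0 < p := hp.out.pos
  induction N with
  | zero =>
    intro k e hk he
    obtain rfl : k = 0 := by simpa using hk
    obtain rfl : e = 0 := by simpa using he
    simp
  | succ N ih =>
    intro k e hk he
    rw [pow_succ'] at hk he
    have hk' : k / p < p ^ N := Nat.div_lt_of_lt_mul hk
    have he' : e / p < p ^ N := Nat.div_lt_of_lt_mul he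
    have hkd := Nat.div_add_mod k p
    have hed := Nat.div_add_mod e p
    have h1 : p ^ (N + 1) * K + k = p * (p ^ N * K + k / p) + k % p := by
      rw [mul_add, add_assoc, hkd]; ring
    have h2 : (p : ℤ) ^ (N + 1) * q + e
        = p * ((p : ℤ) ^ N * q + (e / p : ℕ)) + (e % p : ℕ) := by
      rw [mul_add, add_assoc]
      have : ((p : ℤ) * (e / p : ℕ) + (e % p : ℕ)) = e := by exact_mod_cast hed
      rw [this]; ring
    have h3 := paddedChoose_lucas (p := p) (k / p) (Nat.mod_lt k hp0) (Nat.mod_lt e hp0)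
      ((e / p : ℕ) : ℤ)
    have h4 : (p : ℤ) * (e / p : ℕ) + (e % p : ℕ) = (e : ℕ) := by exact_mod_cast hed
    rw [h4, hkd, paddedChoose_natCast, paddedChoose_natCast] at h3
    rw [h1, h2, paddedChoose_lucas _ (Nat.mod_lt k hp0) (Nat.mod_lt e hp0), ih hk' he', h3,
      mul_assoc]

/-- Any scalar multiple of a padded row occurs, surrounded by many zeros, strictly inside some other
row, at a position divisible by `p`. -/
lemma exists_row_eq_mul_paddedChoose (k M : ℕ) (c : ZMod p) :
    ∃ k' P : ℕ, M ≤ P ∧ P + M ≤ k' ∧ (P : ZMod p) = 0 ∧ (k' : ZMod p) = k ∧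
      ∀ e : ℤ, -M ≤ e → e ≤ M → paddedChoose p k' (P + e) = c * paddedChoose p k e := by
  have hp1 : 1 < p := hp.out.one_lt
  set N := k + M + 1 with hN
  have hlt : N < p ^ N := Nat.lt_pow_self hp1
  have hcp : ((p ^ N : ℕ) : ZMod p) = 0 := by simp [hN, pow_succ]
  -- Here `c.val + p ≥ 2` keeps the copy away from the right end of the new row.
  refine ⟨p ^ N * (c.val + p) + k, p ^ N, by omega, ?_, hcp, ?_, ?_⟩
  · have : p ^ N * 2 ≤ p ^ N * (c.val + p) := Nat.mul_le_mul_left _ (by omega)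
    omega
  · push_cast at hcp ⊢
    simp
  · intro e h1 h2
    rcases lt_or_ge e 0 with he | he
    · obtain ⟨t, ht⟩ : ∃ t : ℕ, (t : ℤ) = (p ^ N : ℕ) + e :=
        ⟨((p ^ N : ℕ) + e).toNat, by omega⟩
      have h := paddedChoose_lucas_pow (p := p) N (c.val + p) 0 (k := k) (e := t) (by omega)
        (by omega)
      rw [mul_zero, zero_add, ht] at h
      rw [h, Nat.choose_eq_zero_of_lt (by omega), paddedChoose_of_neg he]
      simp
    · lift e to ℕ using he
      have h := paddedChoose_lucas_pow (p := p) N (c.val + p) 1 (k := k) (e := e) (by omega)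
        (by omega)
      rw [mul_one] at h
      push_cast
      rw [h, show (1 : ℤ) = ((1 : ℕ) : ℤ) by rfl, paddedChoose_natCast, paddedChoose_natCast]
      simp

/-- Padding the rows by zeros creates no new blocks. -/
lemma isAccessibleBlock_iff {m : ℕ} {b : Fin m → ZMod p} :
    IsAccessibleBlock (1 + Polynomial.X) p m b ↔
      ∃ (k : ℕ) (j : ℤ), ∀ i : Fin m, b i = paddedChoose p k (j + (i : ℕ)) := by
  have hmap : (1 + Polynomial.X : Polynomial ℤ).map (Int.castRingHom (ZMod p))
      = Polynomial.X + 1 := by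
    simp [add_comm]
  have hdeg : ∀ k : ℕ, ((Polynomial.X + 1 : Polynomial (ZMod p)) ^ k).natDegree = k := by
    intro k
    rw [Polynomial.natDegree_pow]
    have := Polynomial.natDegree_X_add_C (1 : ZMod p)
    rw [Polynomial.C_1] at this
    rw [this, mul_one]
  unfold IsAccessibleBlock
  simp only [hmap, hdeg, Polynomial.coeff_X_add_one_pow]
  constructor
  · rintro ⟨k, j, -, h⟩
    refine ⟨k, j, fun i => ?_⟩
    rw [h i, ← Nat.cast_add, paddedChoose_natCast]
  · rintro ⟨k, j, h⟩
    obtain ⟨k', P, h1, h2, -, -, h5⟩ :=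
      exists_row_eq_mul_paddedChoose (p := p) k (j.natAbs + m) 1
    obtain ⟨t, ht⟩ : ∃ t : ℕ, (t : ℤ) = P + j := ⟨(P + j).toNat, by omega⟩
    refine ⟨k', t, by omega, fun i => ?_⟩
    have hi := i.2
    rw [h i, ← one_mul (paddedChoose p k _), ← h5 _ (by omega) (by omega), ← add_assoc, ← ht,
      ← Nat.cast_add, paddedChoose_natCast]

lemma isAccessibleBlock_smul {m : ℕ} {b : Fin m → ZMod p}
    (hb : IsAccessibleBlock (1 + Polynomial.X) p m b) (c : ZMod p) :
    IsAccessibleBlock (1 + Polynomial.X) p m (c • b) := by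
  rw [isAccessibleBlock_iff] at hb ⊢
  obtain ⟨k, j, h⟩ := hb
  obtain ⟨k', P, -, -, -, -, h5⟩ := exists_row_eq_mul_paddedChoose (p := p) k (j.natAbs + m) c
  refine ⟨k', P + j, fun i => ?_⟩
  have hi := i.2
  rw [add_assoc, h5 _ (by omega) (by omega), Pi.smul_apply, smul_eq_mul, h i]

/-! ### Blocks of length at most two -/

lemma accessibleCount_zero : accessibleCount (1 + Polynomial.X) p 0 = 1 := by
  have : {b : Fin 0 → ZMod p | IsAccessibleBlock (1 + Polynomial.X) p 0 b} = {Fin.elim0} := by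
    ext b
    simp only [Set.mem_ofPred_eq, Set.mem_singleton_iff, isAccessibleBlock_iff]
    exact ⟨fun _ => Subsingleton.elim _ _, fun _ => ⟨0, 0, fun i => i.elim0⟩⟩
  rw [accessibleCount, this, Set.ncard_singleton]

lemma accessibleCount_one : accessibleCount (1 + Polynomial.X) p 1 = p := by
  have : {b : Fin 1 → ZMod p | IsAccessibleBlock (1 + Polynomial.X) p 1 b} = Set.univ := by
    refine Set.eq_univ_of_forall fun b => ?_
    rw [Set.mem_ofPred_eq]
    have h1 : IsAccessibleBlock (1 + Polynomial.X) p 1 (fun _ => (1 : ZMod p)) :=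
      isAccessibleBlock_iff.2 ⟨0, 0, fun i => by simp [paddedChoose]⟩
    have := isAccessibleBlock_smul h1 (b 0)
    convert this using 1
    ext i
    simp [Subsingleton.elim i 0]
  rw [accessibleCount, this, Set.ncard_univ]
  simp

lemma accessibleCount_two : accessibleCount (1 + Polynomial.X) p 2 = p ^ 2 := by
  have : {b : Fin 2 → ZMod p | IsAccessibleBlock (1 + Polynomial.X) p 2 b} = Set.univ := by
    refine Set.eq_univ_of_forall fun b => ?_
    rw [Set.mem_ofPred_eq]
    rcases eq_or_ne (b 0) 0 with h0 | h0
    · have h1 : IsAccessibleBlock (1 + Polynomial.X) p 2 ![(0 : ZMod p), 1] :=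
        isAccessibleBlock_iff.2 ⟨0, -1, fun i => by fin_cases i <;> simp [paddedChoose]⟩
      have := isAccessibleBlock_smul h1 (b 1)
      convert this using 1
      ext i
      fin_cases i <;> simp [h0]
    · have h1 : IsAccessibleBlock (1 + Polynomial.X) p 2 ![(1 : ZMod p), b 1 / b 0] :=
        isAccessibleBlock_iff.2 ⟨(b 1 / b 0).val, 0, fun i => by
          fin_cases i <;> simp [paddedChoose]⟩
      have := isAccessibleBlock_smul h1 (b 0)
      convert this using 1
      ext i
      fin_cases i
      · simp
      · simp [mul_div_cancel₀ _ h0]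
  rw [accessibleCount, this, Set.ncard_univ]
  simp

/-! ### Blocks sorted by residues of row and column -/

/-- The `m`-blocks that occur in a padded row whose number is `r` modulo `p`, starting in a column
that is `s` modulo `p`. -/
def residueBlocks (m : ℕ) (r s : ZMod p) : Set (Fin m → ZMod p) :=
  {b | ∃ (k : ℕ) (j : ℤ), (k : ZMod p) = r ∧ (j : ZMod p) = s ∧
    ∀ i : Fin m, b i = paddedChoose p k (j + (i : ℕ))}

/-- Blow up a word `u` to an `m`-block: every digit is replaced by its multiple of row `r`, padded to
length `p`, and the result is read from column `t` on, the digit `u 0` having been written from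
column `p` on. Digits of `u` beyond its length count as zero. Only `t > r` is used, so
that the columns before `p`, where the subtraction below truncates, carry the factor zero. -/
def blowUp (m v r t : ℕ) (u : Fin v → ZMod p) : Fin m → ZMod p := fun i =>
  (r.choose ((t + i) % p) : ZMod p) *
    if h : (t + i) / p - 1 < v then u ⟨(t + i) / p - 1, h⟩ else 0

lemma blowUp_injective {m r d : ℕ} (hm : 0 < m) (hr : r < p) (hd : d < p) :
    Function.Injective
      (blowUp (p := p) m ((m + r + d) / p) r (r + 1 + d)) := by
  have hp0 : 0 < p := hp.out.pos
  intro u u' h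
  funext ⟨q, hq⟩
  have hqm : p * (q + 1) ≤ m + r + d := by
    rw [mul_comm]
    exact (Nat.le_div_iff_mul_le hp0).1 hq
  -- Column `p * (q + 1)` shows the digit `u q`, unless `q = 0` and the block starts later.
  have key : ∃ i : Fin m, (r + 1 + d + i) / p - 1 = q ∧ (r + 1 + d + i) % p ≤ r := by
    rcases le_or_gt (r + 1 + d) (p * (q + 1)) with hle | hgt
    · refine ⟨⟨p * (q + 1) - (r + 1 + d), by omega⟩, ?_, ?_⟩
      · simp only [Nat.add_sub_cancel' hle]
        rw [Nat.mul_div_cancel_left _ hp0]; rfl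
      · simp only [Nat.add_sub_cancel' hle, Nat.mul_mod_right]; omega
    · have hq0 : q = 0 := by
        by_contra hne
        have : p * 2 ≤ p * (q + 1) := Nat.mul_le_mul_left _ (by omega)
        omega
      subst hq0
      obtain ⟨e, he⟩ : ∃ e, r + 1 + d = p * 1 + e := ⟨r + 1 + d - p, by omega⟩
      refine ⟨⟨0, hm⟩, ?_, ?_⟩
      · simp only [add_zero, he]
        rw [Nat.mul_add_div hp0, Nat.div_eq_of_lt (by omega)]
      · simp only [add_zero, he]
        rw [Nat.mul_add_mod, Nat.mod_eq_of_lt (by omega)]; omega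
  obtain ⟨i, hi, hir⟩ := key
  have h1 := congrFun h i
  have hc : (r.choose ((r + 1 + d + i) % p) : ZMod p) ≠ 0 := by
    rw [Ne, ZMod.natCast_eq_zero_iff]
    intro hdvd
    have : p ∣ r.factorial := by
      rw [← Nat.choose_mul_factorial_mul_factorial hir, mul_assoc]
      exact hdvd.mul_right _
    exact absurd ((hp.out.dvd_factorial).1 this) (by omega)
  simp only [blowUp, hi, hq, dite_true] at h1
  exact mul_left_cancel₀ hc h1

/-- The blocks with given residues are the blow-ups of the accessible blocks of the length that is
visible through a window of length `m`. -/
lemma residueBlocks_eq_image {m : ℕ} (r s : ZMod p) :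
    residueBlocks m r s =
      blowUp m ((m + r.val + (s - r - 1).val) / p) r.val (r.val + 1 + (s - r - 1).val) ''
        {u | IsAccessibleBlock (1 + Polynomial.X) p _ u} := by
  have hp0 : 0 < p := hp.out.pos
  set R := r.val with hR
  set d := (s - r - 1).val with hd
  have hRp : R < p := ZMod.val_lt r
  have hdp : d < p := ZMod.val_lt _
  have hcR : (R : ZMod p) = r := ZMod.natCast_zmod_val r
  have hcd : (d : ZMod p) = s - r - 1 := ZMod.natCast_zmod_val _
  have hst : ((R + 1 + d : ℕ) : ZMod p) = s := by push_cast; rw [hcR, hcd]; ring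
  have key : ∀ (k : ℕ) (j : ℤ) (i : Fin m),
      paddedChoose p (p * k + R) (p * (j - 1) + (R + 1 + d : ℕ) + (i : ℕ)) =
        blowUp m ((m + R + d) / p) R (R + 1 + d)
          (fun q => paddedChoose p k (j + (q : ℕ))) i := by
    intro k j i
    have hi := i.2
    have hdm := Nat.div_add_mod (R + 1 + d + i) p
    set Q := (R + 1 + d + i) / p with hQ
    have h1 : (p : ℤ) * (j - 1) + (R + 1 + d : ℕ) + (i : ℕ)
        = p * (j - 1 + Q) + ((R + 1 + d + i) % p : ℕ) := by
      have : ((p : ℤ) * Q + ((R + 1 + d + i) % p : ℕ)) = (R + 1 + d : ℕ) + (i : ℕ) := by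
        exact_mod_cast hdm
      linear_combination -this
    rw [h1, paddedChoose_lucas _ hRp (Nat.mod_lt _ hp0), mul_comm]
    unfold blowUp
    rcases Nat.eq_zero_or_pos Q with h0 | h0
    · have hlt : R < (R + 1 + d + i) % p := by
        rw [h0] at hdm
        omega
      rw [Nat.choose_eq_zero_of_lt hlt]
      simp
    · have hlt : Q - 1 < (m + R + d) / p := by
        have : Q ≤ (m + R + d) / p := Nat.div_le_div_right (by omega)
        omega
      rw [dif_pos hlt]
      congr 2
      simp only [← hQ]
      push_cast [h0]
      ring
  ext b
  constructor
  · rintro ⟨k, j, hk, hj, hb⟩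
    have hk' : p * (k / p) + R = k := by
      have : k % p = R := by rw [hR, ← hk, ZMod.val_natCast]
      rw [← this, Nat.div_add_mod]
    obtain ⟨j', hj'⟩ : ∃ j' : ℤ, j = p * (j' - 1) + (R + 1 + d : ℕ) := by
      have : ((p : ℤ)) ∣ j - (R + 1 + d : ℕ) := by
        rw [← ZMod.intCast_eq_intCast_iff_dvd_sub, hj, ← hst]
        push_cast; rfl
      obtain ⟨x, hx⟩ := this
      exact ⟨x + 1, by linear_combination hx⟩
    refine ⟨fun q => paddedChoose p (k / p) (j' + (q : ℕ)),
      isAccessibleBlock_iff.2 ⟨k / p, j', fun _ => rfl⟩, ?_⟩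
    funext i
    rw [← key, hk', hb i, hj']
  · rintro ⟨u, hu, rfl⟩
    obtain ⟨k, j, hu⟩ := isAccessibleBlock_iff.1 hu
    obtain rfl : u = fun q : Fin _ => paddedChoose p k (j + (q : ℕ)) := funext hu
    refine ⟨p * k + R, p * (j - 1) + (R + 1 + d : ℕ), ?_, ?_, fun i => (key k j i).symm⟩
    · simp [hcR]
    · rw [← hst]; simp

lemma ncard_residueBlocks {m : ℕ} (hm : 0 < m) (r s : ZMod p) :
    (residueBlocks m r s).ncard =
      accessibleCount (1 + Polynomial.X) p ((m + r.val + (s - r - 1).val) / p) := by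
  rw [residueBlocks_eq_image, Set.ncard_image_of_injective _
    (blowUp_injective hm (ZMod.val_lt _) (ZMod.val_lt _)), accessibleCount]

/-- Each pair of adjacent digits gives a linear equation for the two residues. -/
lemma residueBlocks_relation {m : ℕ} {r s : ZMod p} {b : Fin m → ZMod p}
    (hb : b ∈ residueBlocks m r s) {i : ℕ} (hi : i + 1 < m) :
    (b ⟨i, by omega⟩ + b ⟨i + 1, hi⟩) * (s + i + 1) = b ⟨i, by omega⟩ * (r + 1) := by
  obtain ⟨k, j, rfl, rfl, h⟩ := hb
  rw [h, h]
  have := paddedChoose_add_succ_mul p k (j + i)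
  push_cast at this ⊢
  rw [← this, add_assoc (j : ℤ)]

/-! ### Blocks that occur with several residues -/

/-- The `m`-block `0, …, 0, c`. -/
def rightUnitBlock (m : ℕ) (c : ZMod p) : Fin m → ZMod p := fun i =>
  if (i : ℕ) + 1 = m then c else 0

/-- The `m`-block `c, 0, …, 0`. -/
def leftUnitBlock (m : ℕ) (c : ZMod p) : Fin m → ZMod p := fun i =>
  if (i : ℕ) = 0 then c else 0

/-- The `m`-block `c, -c, c, …`. -/
def alternatingBlock (m : ℕ) (c : ZMod p) : Fin m → ZMod p := fun i => c * (-1) ^ (i : ℕ)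

lemma zero_mem_residueBlocks (m : ℕ) (r s : ZMod p) :
    (0 : Fin m → ZMod p) ∈ residueBlocks m r s := by
  refine ⟨r.val, s.val - p * (m + 1), ZMod.natCast_zmod_val r, ?_, fun i => ?_⟩
  · push_cast; simp
  · have h1 := i.2
    have h2 := ZMod.val_lt s
    have h3 : m ≤ p * m := Nat.le_mul_of_pos_left m hp.out.pos
    rw [paddedChoose_of_neg, Pi.zero_apply]
    zify at h1 h2 h3
    linarith

lemma rightUnitBlock_mem_residueBlocks {m : ℕ} (hm : 2 ≤ m) {c : ZMod p} (hc : c ≠ 0)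
    (r s : ZMod p) : rightUnitBlock m c ∈ residueBlocks m r s ↔ s = 1 - m := by
  constructor
  · intro h
    obtain ⟨n, rfl⟩ := Nat.exists_eq_add_of_le' hm
    have h1 := residueBlocks_relation h (i := n) (by omega)
    have e0 : rightUnitBlock (n + 2) c ⟨n, by omega⟩ = 0 := if_neg (by simp)
    have e1 : rightUnitBlock (n + 2) c ⟨n + 1, by omega⟩ = c := if_pos rfl
    rw [e0, e1, zero_add, zero_mul, mul_eq_zero, or_iff_right hc] at h1
    push_cast
    linear_combination h1
  · rintro rfl
    obtain ⟨k', P, -, -, h3, h4, h5⟩ := exists_row_eq_mul_paddedChoose (p := p) r.val m c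
    refine ⟨k', P + (1 - m), by rw [h4, ZMod.natCast_zmod_val], by push_cast; rw [h3]; ring,
      fun i => ?_⟩
    have hi := i.2
    rw [add_assoc, h5 _ (by omega) (by omega), rightUnitBlock]
    split_ifs with h
    · rw [show (1 - (m : ℤ) + (i : ℕ)) = ((0 : ℕ) : ℤ) by omega, paddedChoose_natCast]
      simp
    · rw [paddedChoose_of_neg (by omega), mul_zero]

lemma leftUnitBlock_mem_residueBlocks {m : ℕ} (hm : 2 ≤ m) {c : ZMod p} (hc : c ≠ 0)
    (r s : ZMod p) : leftUnitBlock m c ∈ residueBlocks m r s ↔ s = r := by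
  constructor
  · intro h
    have h1 := residueBlocks_relation h (i := 0) (by omega)
    simp only [leftUnitBlock] at h1
    rw [if_pos trivial, if_neg (by omega), add_zero] at h1
    have h2 := mul_left_cancel₀ hc h1
    push_cast at h2
    linear_combination h2
  · rintro rfl
    have hs := ZMod.val_lt s
    obtain ⟨k', P, -, -, h3, h4, h5⟩ := exists_row_eq_mul_paddedChoose (p := p) s.val (p + m) c
    refine ⟨k', P + s.val, by rw [h4, ZMod.natCast_zmod_val], by push_cast; simp [h3],
      fun i => ?_⟩
    have hi := i.2
    rw [add_assoc, h5 _ (by omega) (by omega), leftUnitBlock, ← Nat.cast_add, paddedChoose_natCast]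
    split_ifs with h
    · simp [h]
    · rw [Nat.choose_eq_zero_of_lt (by omega)]; simp

lemma choose_prime_pow_sub_one (N : ℕ) {e : ℕ} (he : e < p ^ N) :
    ((p ^ N - 1).choose e : ZMod p) = (-1) ^ e := by
  induction e with
  | zero => simp
  | succ e ih =>
    have h1 : ((p ^ N).choose (e + 1) : ZMod p) = 0 := by
      rw [ZMod.natCast_eq_zero_iff]
      exact hp.out.dvd_choose_pow (by omega) (by omega)
    obtain ⟨q, hq⟩ : ∃ q, p ^ N = q + 1 := ⟨p ^ N - 1, by omega⟩
    rw [hq, Nat.choose_succ_succ] at h1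
    rw [hq, Nat.add_sub_cancel] at ih ⊢
    push_cast at h1
    rw [pow_succ, ← ih (by omega)]
    linear_combination h1

lemma alternatingBlock_mem_residueBlocks {m : ℕ} (hm : 2 ≤ m) {c : ZMod p} (hc : c ≠ 0)
    (r s : ZMod p) : alternatingBlock m c ∈ residueBlocks m r s ↔ r = -1 := by
  constructor
  · intro h
    have h1 := residueBlocks_relation h (i := 0) (by omega)
    simp only [alternatingBlock] at h1
    have h2 : c * (r + 1) = 0 := by linear_combination -h1
    rw [mul_eq_zero, or_iff_right hc] at h2
    linear_combination h2
  · rintro rfl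
    have hs := ZMod.val_lt s
    have hlt : p + m < p ^ (p + m) := Nat.lt_pow_self hp.out.one_lt
    obtain ⟨k', P, -, -, h3, h4, h5⟩ := exists_row_eq_mul_paddedChoose (p := p)
      (p ^ (p + m) - 1) (p + m) (c * (-1) ^ s.val)
    have hp0 := hp.out.pos
    refine ⟨k', P + s.val, ?_, by push_cast; simp [h3], fun i => ?_⟩
    · rw [h4, Nat.cast_sub (by omega)]
      push_cast
      rw [ZMod.natCast_self, zero_pow (by omega)]
      ring
    · have hi := i.2
      rw [add_assoc, h5 _ (by omega) (by omega), alternatingBlock, ← Nat.cast_add,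
        paddedChoose_natCast, choose_prime_pow_sub_one _ (by omega), pow_add]
      have : ((-1 : ZMod p) ^ s.val) * (-1) ^ s.val = 1 := by
        rw [← mul_pow]; simp
      linear_combination -c * (-1) ^ (i : ℕ) * this

/-- The linear equations given by adjacent digits have a unique solution, unless all pairs of
adjacent digits are proportional; a geometric progression is then excluded, because the equations
would be inconsistent, unless its ratio is `0` or `-1`. -/
lemma residues_unique {m : ℕ} (hm : 3 ≤ m) {r s r' s' : ZMod p} {b : Fin m → ZMod p}
    (h : b ∈ residueBlocks m r s) (h' : b ∈ residueBlocks m r' s') :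
    (r = r' ∧ s = s') ∨
      ∃ c, b = rightUnitBlock m c ∨ b = leftUnitBlock m c ∨ b = alternatingBlock m c := by
  obtain ⟨w, hw⟩ : ∃ w : ℕ → ZMod p, ∀ i : Fin m, b i = w i :=
    ⟨fun i => if h : i < m then b ⟨i, h⟩ else 0, fun i => by simp⟩
  have hrel : ∀ i, i + 1 < m → (w i + w (i + 1)) * (s + i + 1) = w i * (r + 1) := by
    intro i hi
    have := residueBlocks_relation h hi
    rwa [hw, hw] at this
  have hdiff : ∀ i, i + 1 < m → (w i + w (i + 1)) * (s - s') = w i * (r - r') := by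
    intro i hi
    have := residueBlocks_relation h' hi
    rw [hw, hw] at this
    linear_combination hrel i hi - this
  by_cases hs : s = s'
  · by_cases hr : r = r'
    · exact Or.inl ⟨hr, hs⟩
    · refine Or.inr ⟨w (m - 1), Or.inl ?_⟩
      funext i
      have hi := i.2
      rw [hw, rightUnitBlock]
      split_ifs with h1
      · congr 1; omega
      · have h2 := hdiff i (by omega)
        rw [hs, sub_self, mul_zero, eq_comm, mul_eq_zero, or_iff_left (sub_ne_zero.2 hr)] at h2
        exact h2
  · have hs0 : s - s' ≠ 0 := sub_ne_zero.2 hs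
    obtain ⟨l, hl⟩ : ∃ l : ZMod p, (l + 1) * (s - s') = r - r' :=
      ⟨(r - r') / (s - s') - 1, by rw [sub_add_cancel, div_mul_cancel₀ _ hs0]⟩
    have hstep : ∀ i, i + 1 < m → w (i + 1) = w i * l := by
      intro i hi
      refine mul_right_cancel₀ hs0 ?_
      linear_combination hdiff i hi - w i * hl
    have hgeom : ∀ i, i < m → w i = w 0 * l ^ i := by
      intro i
      induction i with
      | zero => intro _; simp
      | succ i ih => intro hi; rw [hstep i hi, ih (by omega), pow_succ, mul_assoc]
    right
    rcases eq_or_ne (w 0) 0 with h0 | h0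
    · refine ⟨0, Or.inr (Or.inr ?_)⟩
      funext i
      rw [hw, hgeom i i.2, h0, alternatingBlock, zero_mul, zero_mul]
    rcases eq_or_ne l 0 with hl0 | hl0
    · refine ⟨w 0, Or.inr (Or.inl ?_)⟩
      funext i
      rw [hw, hgeom i i.2, hl0, leftUnitBlock]
      split_ifs with h1
      · simp [h1]
      · simp [h1]
    · refine ⟨w 0, Or.inr (Or.inr ?_)⟩
      have e0 := hrel 0 (by omega)
      have e1 := hrel 1 (by omega)
      have d0 := hstep 0 (by omega)
      have d1 := hstep 1 (by omega)
      push_cast at e0 e1 d0 d1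
      norm_num at e0 e1 d1
      rw [d1, d0] at e1
      rw [d0] at e0
      have hl1 : w 0 * l * (1 + l) = 0 := by linear_combination e1 - l * e0
      rw [mul_eq_zero, or_iff_right (mul_ne_zero h0 hl0)] at hl1
      obtain rfl : l = -1 := by linear_combination hl1
      funext i
      rw [hw, hgeom i i.2, alternatingBlock]

variable (p) in
open Classical in
/-- The nonzero `m`-blocks that occur with several residues. -/
noncomputable def ambiguousBlocks (m : ℕ) : Finset (Fin m → ZMod p) :=
  (Finset.univ.erase 0).image (rightUnitBlock m) ∪ (Finset.univ.erase 0).image (leftUnitBlock m) ∪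
    (Finset.univ.erase 0).image (alternatingBlock m)

lemma mem_ambiguousBlocks {m : ℕ} {b : Fin m → ZMod p} :
    b ∈ ambiguousBlocks p m ↔ ∃ c ≠ 0,
      b = rightUnitBlock m c ∨ b = leftUnitBlock m c ∨ b = alternatingBlock m c := by
  classical
  simp only [ambiguousBlocks, Finset.mem_union, Finset.mem_image, Finset.mem_erase,
    Finset.mem_univ, and_true]
  constructor
  · rintro ((⟨c, hc, rfl⟩ | ⟨c, hc, rfl⟩) | ⟨c, hc, rfl⟩)
    exacts [⟨c, hc, Or.inl rfl⟩, ⟨c, hc, Or.inr (Or.inl rfl)⟩, ⟨c, hc, Or.inr (Or.inr rfl)⟩]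
  · rintro ⟨c, hc, rfl | rfl | rfl⟩
    exacts [Or.inl (Or.inl ⟨c, hc, rfl⟩), Or.inl (Or.inr ⟨c, hc, rfl⟩), Or.inr ⟨c, hc, rfl⟩]

lemma rightUnitBlock_last {m : ℕ} (hm : 0 < m) (c : ZMod p) :
    rightUnitBlock m c ⟨m - 1, by omega⟩ = c := if_pos (by simp only; omega)

lemma rightUnitBlock_first {m : ℕ} (hm : 2 ≤ m) (c : ZMod p) :
    rightUnitBlock m c ⟨0, by omega⟩ = 0 := if_neg (by simp only; omega)

lemma leftUnitBlock_first {m : ℕ} (hm : 0 < m) (c : ZMod p) :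
    leftUnitBlock m c ⟨0, hm⟩ = c := rfl

lemma alternatingBlock_first {m : ℕ} (hm : 0 < m) (c : ZMod p) :
    alternatingBlock m c ⟨0, hm⟩ = c := by simp [alternatingBlock]

lemma card_ambiguousBlocks {m : ℕ} (hm : 2 ≤ m) : (ambiguousBlocks p m).card = 3 * (p - 1) := by
  classical
  have hcard : (Finset.univ.erase (0 : ZMod p)).card = p - 1 := by
    rw [Finset.card_erase_of_mem (Finset.mem_univ _), Finset.card_univ, ZMod.card]
  have i1 : Function.Injective (rightUnitBlock (p := p) m) := fun c c' h => by
    rw [← rightUnitBlock_last (by omega : 0 < m) c, h, rightUnitBlock_last (by omega)]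
  have i2 : Function.Injective (leftUnitBlock (p := p) m) := fun c c' h => by
    rw [← leftUnitBlock_first (by omega : 0 < m) c, h, leftUnitBlock_first]
  have i3 : Function.Injective (alternatingBlock (p := p) m) := fun c c' h => by
    rw [← alternatingBlock_first (by omega : 0 < m) c, h, alternatingBlock_first]
  rw [ambiguousBlocks, Finset.card_union_of_disjoint, Finset.card_union_of_disjoint,
    Finset.card_image_of_injective _ i1, Finset.card_image_of_injective _ i2,
    Finset.card_image_of_injective _ i3, hcard]
  · ring
  · rw [Finset.disjoint_left]
    simp only [Finset.mem_image, Finset.mem_erase, Finset.mem_univ, and_true]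
    rintro _ ⟨c, hc, rfl⟩ ⟨c', hc', h⟩
    have := congrFun h ⟨0, by omega⟩
    rw [rightUnitBlock_first hm, leftUnitBlock_first] at this
    exact hc' this
  · rw [Finset.disjoint_left]
    simp only [Finset.mem_union, Finset.mem_image, Finset.mem_erase, Finset.mem_univ, and_true]
    rintro _ (⟨c, hc, rfl⟩ | ⟨c, hc, rfl⟩) ⟨c', hc', h⟩
    · have := congrFun h ⟨0, by omega⟩
      rw [rightUnitBlock_first hm, alternatingBlock_first] at this
      exact hc' this
    · have := congrFun h ⟨1, by omega⟩
      simp [alternatingBlock, leftUnitBlock] at this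
      exact hc' this

lemma zero_notMem_ambiguousBlocks {m : ℕ} (hm : 0 < m) : 0 ∉ ambiguousBlocks p m := by
  rw [mem_ambiguousBlocks]
  rintro ⟨c, hc, h | h | h⟩
  · exact hc (by rw [← rightUnitBlock_last hm c, ← h]; rfl)
  · exact hc (by rw [← leftUnitBlock_first hm c, ← h]; rfl)
  · exact hc (by rw [← alternatingBlock_first hm c, ← h]; rfl)

/-! ### The recurrence for the number of accessible blocks -/

lemma isAccessibleBlock_iff_exists_residues {m : ℕ} {b : Fin m → ZMod p} :
    IsAccessibleBlock (1 + Polynomial.X) p m b ↔ ∃ r s, b ∈ residueBlocks m r s := by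
  rw [isAccessibleBlock_iff]
  exact ⟨fun ⟨k, j, h⟩ => ⟨k, j, k, j, rfl, rfl, h⟩, fun ⟨_, _, k, j, _, _, h⟩ => ⟨k, j, h⟩⟩

open Classical in
/-- A block occurs with `p ^ 2`, `p`, `1` or `0` pairs of residues, according to whether it is zero,
ambiguous, otherwise accessible, or inaccessible. -/
lemma card_residues {m : ℕ} (hm : 3 ≤ m) (b : Fin m → ZMod p) :
    (Finset.univ.filter fun x : ZMod p × ZMod p => b ∈ residueBlocks m x.1 x.2).card =
      (if IsAccessibleBlock (1 + Polynomial.X) p m b then 1 else 0)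
        + (if b ∈ ambiguousBlocks p m then p - 1 else 0) + (if b = 0 then p ^ 2 - 1 else 0) := by
  have hp0 := hp.out.pos
  have hm2 : 2 ≤ m := by omega
  rcases eq_or_ne b 0 with rfl | hb
  · have hacc : IsAccessibleBlock (1 + Polynomial.X) p m 0 :=
      isAccessibleBlock_iff_exists_residues.2 ⟨0, 0, zero_mem_residueBlocks m 0 0⟩
    simp only [zero_mem_residueBlocks, Finset.filter_true, if_pos hacc,
      if_neg (zero_notMem_ambiguousBlocks (p := p) (by omega : 0 < m)), if_true, Finset.card_univ,
      Fintype.card_prod, ZMod.card]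
    have : 0 < p ^ 2 := by positivity
    rw [← sq]; omega
  by_cases hamb : b ∈ ambiguousBlocks p m
  · have key : (Finset.univ.filter fun x : ZMod p × ZMod p =>
        b ∈ residueBlocks m x.1 x.2).card = p := by
      obtain ⟨c, hc, rfl | rfl | rfl⟩ := mem_ambiguousBlocks.1 hamb
      · simp only [rightUnitBlock_mem_residueBlocks hm2 hc]
        rw [show (Finset.univ.filter fun x : ZMod p × ZMod p => x.2 = 1 - m)
          = Finset.univ ×ˢ {1 - (m : ZMod p)} by ext ⟨_, _⟩; simp [eq_comm]]
        simp
      · simp only [leftUnitBlock_mem_residueBlocks hm2 hc]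
        rw [show (Finset.univ.filter fun x : ZMod p × ZMod p => x.2 = x.1)
          = Finset.univ.diag by ext; simp [eq_comm]]
        simp
      · simp only [alternatingBlock_mem_residueBlocks hm2 hc]
        rw [show (Finset.univ.filter fun x : ZMod p × ZMod p => x.1 = -1)
          = {-1} ×ˢ Finset.univ by ext ⟨_, _⟩; simp [eq_comm]]
        simp
    have hacc : IsAccessibleBlock (1 + Polynomial.X) p m b := by
      obtain ⟨x, hx⟩ := Finset.card_pos.1 (key ▸ hp0)
      exact isAccessibleBlock_iff_exists_residues.2 ⟨x.1, x.2, (Finset.mem_filter.1 hx).2⟩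
    rw [key, if_pos hacc, if_pos hamb, if_neg hb]
    omega
  rw [if_neg hamb, if_neg hb, add_zero, add_zero]
  split_ifs with hacc
  · obtain ⟨r, s, h⟩ := isAccessibleBlock_iff_exists_residues.1 hacc
    rw [Finset.card_eq_one]
    refine ⟨(r, s), Finset.eq_singleton_iff_unique_mem.2 ⟨by simpa using h, ?_⟩⟩
    rintro ⟨r', s'⟩ hx
    rcases residues_unique hm h (Finset.mem_filter.1 hx).2 with ⟨rfl, rfl⟩ | ⟨c, hc⟩
    · rfl
    · refine absurd (mem_ambiguousBlocks.2 ⟨c, ?_, hc⟩) hamb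
      rintro rfl
      refine hb ?_
      rcases hc with rfl | rfl | rfl <;> funext i <;>
        simp [rightUnitBlock, leftUnitBlock, alternatingBlock]
  · rw [Finset.card_eq_zero, Finset.filter_eq_empty_iff]
    exact fun x _ hx => hacc (isAccessibleBlock_iff_exists_residues.2 ⟨x.1, x.2, hx⟩)

lemma sum_zmod_val {M : Type*} [AddCommMonoid M] (g : ℕ → M) :
    ∑ x : ZMod p, g x.val = ∑ i ∈ Finset.range p, g i :=
  Finset.sum_nbij' ZMod.val Nat.cast (fun x _ => Finset.mem_range.2 (ZMod.val_lt x))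
    (fun _ _ => Finset.mem_univ _) (fun x _ => ZMod.natCast_zmod_val x)
    (fun _ hi => ZMod.val_cast_of_lt (Finset.mem_range.1 hi)) (fun _ _ => rfl)

/-- The recurrence, by counting in two ways the pairs of a block and its possible residues. -/
lemma sum_accessibleCount_div {m : ℕ} (hm : 3 ≤ m) :
    ∑ r ∈ Finset.range p, ∑ d ∈ Finset.range p,
        accessibleCount (1 + Polynomial.X) p ((m + r + d) / p)
      = accessibleCount (1 + Polynomial.X) p m + 3 * (p - 1) * (p - 1) + (p ^ 2 - 1) := by
  classical
  have h1 : ∑ r ∈ Finset.range p, ∑ d ∈ Finset.range p,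
        accessibleCount (1 + Polynomial.X) p ((m + r + d) / p)
      = ∑ x : ZMod p × ZMod p, (residueBlocks m x.1 x.2).ncard := by
    rw [Fintype.sum_prod_type, ← sum_zmod_val]
    refine Finset.sum_congr rfl fun r _ => ?_
    rw [← sum_zmod_val (p := p) fun d =>
      accessibleCount (1 + Polynomial.X) p ((m + r.val + d) / p)]
    simp only [ncard_residueBlocks (by omega : 0 < m)]
    exact (Equiv.sum_comp ((Equiv.subRight r).trans (Equiv.subRight 1)) fun x : ZMod p =>
      accessibleCount (1 + Polynomial.X) p ((m + r.val + x.val) / p)).symm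
  have h2 : ∀ x : ZMod p × ZMod p, (residueBlocks m x.1 x.2).ncard
      = (Finset.univ.filter fun b : Fin m → ZMod p => b ∈ residueBlocks m x.1 x.2).card := by
    intro x
    rw [← Set.ncard_coe_finset]
    congr 1
    ext b
    simp
  have h3 : accessibleCount (1 + Polynomial.X) p m
      = (Finset.univ.filter fun b : Fin m → ZMod p =>
          IsAccessibleBlock (1 + Polynomial.X) p m b).card := by
    rw [accessibleCount, ← Set.ncard_coe_finset]
    congr 1
    ext b
    simp
  rw [h1, Finset.sum_congr rfl fun x _ => h2 x]
  have h4 := Finset.sum_card_bipartiteAbove_eq_sum_card_bipartiteBelow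
    (s := (Finset.univ : Finset (ZMod p × ZMod p))) (t := (Finset.univ : Finset (Fin m → ZMod p)))
    fun x b => b ∈ residueBlocks m x.1 x.2
  simp only [Finset.bipartiteAbove, Finset.bipartiteBelow] at h4
  rw [h4, Finset.sum_congr rfl fun b _ => card_residues hm b, Finset.sum_add_distrib,
    Finset.sum_add_distrib, Finset.sum_ite_mem, Finset.univ_inter, Finset.sum_const,
    card_ambiguousBlocks (by omega), h3, Finset.card_filter, Finset.sum_ite_eq',
    if_pos (Finset.mem_univ _), smul_eq_mul]

end Prime

/-! ### Solving the recurrence -/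

lemma sum_range_shift_sub (g : ℕ → ℚ) (n m : ℕ) :
    ∑ d ∈ Finset.range n, g (m + 1 + d) - ∑ d ∈ Finset.range n, g (m + d) = g (m + n) - g m := by
  have h1 := Finset.sum_range_succ (fun d => g (m + d)) n
  have h2 := Finset.sum_range_succ' (fun d => g (m + d)) n
  have h3 : ∀ d, g (m + (d + 1)) = g (m + 1 + d) := fun d => by rw [add_assoc, add_comm 1]
  simp only [h3, add_zero] at h2
  linarith

/-- The second difference `a (n + 2) - 2 a (n + 1) + a n`. -/
def secondDiff (a : ℕ → ℚ) (n : ℕ) : ℚ := a (n + 2) - 2 * a (n + 1) + a n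

/-- The second difference of the double sum on the left telescopes. -/
lemma secondDiff_sum_div {p : ℕ} (hp : 0 < p) (a : ℕ → ℚ) (m : ℕ) :
    secondDiff (fun m => ∑ r ∈ Finset.range p, ∑ d ∈ Finset.range p, a ((m + r + d) / p)) m
      = secondDiff a (m / p) := by
  have hU := sum_range_shift_sub (fun n => a (n / p)) p
  have hT := sum_range_shift_sub (fun n => ∑ d ∈ Finset.range p, a ((n + d) / p)) p
  have e0 := hT m
  have e1 := hT (m + 1)
  have u0 := hU m
  have u1 := hU (m + p)
  simp only [Nat.add_div_right _ hp] at u0 u1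
  rw [add_right_comm m 1 p] at e1
  unfold secondDiff
  simp only [add_assoc, Nat.reduceAdd] at *
  linarith

/-- The coefficient of `z ^ n` in `lacunaryTerm p i`. -/
def lacunaryCoeff (p i n : ℕ) : ℚ :=
  (if n = p ^ i then (p : ℚ) else 0) - (if n = 2 * p ^ i then 2 * ((p : ℚ) - 1) else 0)
    + (if n = 3 * p ^ i then (p : ℚ) - 2 else 0)

lemma coeff_lacunaryTerm (p i n : ℕ) :
    PowerSeries.coeff n (lacunaryTerm p i) = lacunaryCoeff p i n := by
  rw [lacunaryTerm, map_add, map_sub, PowerSeries.coeff_C_mul, PowerSeries.coeff_C_mul,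
    PowerSeries.coeff_C_mul, PowerSeries.coeff_X_pow, PowerSeries.coeff_X_pow,
    PowerSeries.coeff_X_pow, mul_ite, mul_ite, mul_ite]
  simp only [mul_one, mul_zero, lacunaryCoeff]

lemma lacunaryCoeff_eq_zero {p : ℕ} (hp : 1 < p) {i n : ℕ} (h : n ≤ i) :
    lacunaryCoeff p i n = 0 := by
  have : i < p ^ i := Nat.lt_pow_self hp
  rw [lacunaryCoeff, if_neg (by omega), if_neg (by omega), if_neg (by omega)]
  simp

lemma lacunaryCoeff_succ_mul {p : ℕ} (hp : 0 < p) (i n : ℕ) :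
    lacunaryCoeff p (i + 1) (p * n) = lacunaryCoeff p i n := by
  have h : ∀ c, p * n = c * p ^ (i + 1) ↔ n = c * p ^ i := fun c => by
    rw [show c * p ^ (i + 1) = p * (c * p ^ i) by ring, Nat.mul_right_inj hp.ne']
  have h1 := h 1
  rw [one_mul, one_mul] at h1
  simp only [lacunaryCoeff, h, h1]

lemma lacunaryCoeff_succ_of_not_dvd {p n : ℕ} (i : ℕ) (h : ¬ p ∣ n) :
    lacunaryCoeff p (i + 1) n = 0 := by
  have h' : ∀ c, n ≠ c * p ^ (i + 1) := fun c hc =>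
    h ⟨c * p ^ i, by rw [hc]; ring⟩
  have h1 := h' 1
  rw [one_mul] at h1
  simp [lacunaryCoeff, h', h1]

/-- The third differences of a sequence that satisfies the recurrence are lacunary. -/
lemma secondDiff_succ_sub {p : ℕ} (hp : 3 ≤ p) {a : ℕ → ℚ} (h0 : a 0 = 1) (h1 : a 1 = p)
    (h2 : a 2 = (p : ℚ) ^ 2)
    (hrec : ∀ m, 3 ≤ m → ∑ r ∈ Finset.range p, ∑ d ∈ Finset.range p, a ((m + r + d) / p)
      = a m + 3 * ((p : ℚ) - 1) * (p - 1) + ((p : ℚ) ^ 2 - 1)) (n : ℕ) :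
    ∀ N, n < N → secondDiff a (n + 1) - secondDiff a n
      = ((p : ℚ) - 1) ^ 2 / 2 * ∑ i ∈ Finset.range (N + 1), lacunaryCoeff p i (n + 1) := by
  have hp0 : 0 < p := by omega
  set T : ℕ → ℚ := fun m => ∑ r ∈ Finset.range p, ∑ d ∈ Finset.range p, a ((m + r + d) / p)
    with hT
  have hD : ∀ m, secondDiff T m = secondDiff a (m / p) := secondDiff_sum_div hp0 a
  have hstep : ∀ m, 3 ≤ m → secondDiff a m = secondDiff a (m / p) := by
    intro m hm
    rw [← hD, secondDiff, secondDiff]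
    linarith [hrec m hm, hrec (m + 1) (by omega), hrec (m + 2) (by omega)]
  -- The inner sums `∑ d, a ((r + d) / p)` form an arithmetic progression for `r ≤ p`.
  have hU : ∀ r, r ≤ p → ∑ d ∈ Finset.range p, a ((r + d) / p) = p + r * ((p : ℚ) - 1) := by
    intro r
    induction r with
    | zero =>
      intro _
      have : ∀ d ∈ Finset.range p, a ((0 + d) / p) = 1 := fun d hd => by
        rw [zero_add, Nat.div_eq_of_lt (Finset.mem_range.1 hd), h0]
      rw [Finset.sum_congr rfl this]
      simp
    | succ r ih =>
      intro hr
      have e := sum_range_shift_sub (fun n => a (n / p)) p r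
      simp only [Nat.add_div_right _ hp0, Nat.div_eq_of_lt (show r < p by omega), zero_add,
        h0, h1] at e
      rw [ih (by omega)] at e
      push_cast
      linarith
  have hT0 : T 0 = (p : ℚ) ^ 2 + ((p : ℚ) - 1) ^ 2 * p / 2 := by
    have e : T 0 = ∑ r ∈ Finset.range p, ((p : ℚ) + r * ((p : ℚ) - 1)) := by
      refine Finset.sum_congr rfl fun r hr => ?_
      rw [← hU r (Finset.mem_range.1 hr).le]
      simp only [zero_add]
    have g := Finset.sum_range_id_mul_two p
    have g' : (∑ r ∈ Finset.range p, (r : ℚ)) * 2 = p * ((p : ℚ) - 1) := by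
      have := congrArg (Nat.cast : ℕ → ℚ) g
      push_cast [Nat.cast_sub (show 1 ≤ p by omega)] at this
      exact this
    rw [e, Finset.sum_add_distrib, ← Finset.sum_mul]
    simp only [Finset.sum_const, Finset.card_range, nsmul_eq_mul]
    linear_combination ((p : ℚ) - 1) / 2 * g'
  have hT1 : T 1 - T 0 = p * ((p : ℚ) - 1) := by
    have e := sum_range_shift_sub (fun n => ∑ d ∈ Finset.range p, a ((n + d) / p)) p 0
    simp only [zero_add, hU p le_rfl] at e
    have e0 := hU 0 (by omega)
    simp only [zero_add] at e0
    simp only [hT, zero_add]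
    rw [e0] at e
    push_cast at e
    linarith
  have d0 := hD 0
  have d1 := hD 1
  have d2 := hD 2
  rw [Nat.div_eq_of_lt (by omega)] at d0 d1 d2
  have r3 := hrec 3 le_rfl
  have r4 := hrec 4 (by omega)
  change T 3 = _ at r3
  change T 4 = _ at r4
  have s0 : secondDiff a 0 = ((p : ℚ) - 1) ^ 2 := by
    simp only [secondDiff, zero_add, h0, h1, h2]; ring
  rw [s0] at d0 d1 d2
  have s1 : secondDiff a 1 = ((p : ℚ) - 1) ^ 2 * (1 + p / 2) := by
    simp only [secondDiff, Nat.reduceAdd, h1, h2] at d0 d1 ⊢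
    linear_combination -r3 + d1 + 2 * d0 + 3 * hT1 + hT0
  have s2 : secondDiff a 2 = ((p : ℚ) - 1) ^ 2 * (2 - p / 2) := by
    simp only [secondDiff, Nat.reduceAdd, h2] at d0 d1 d2 ⊢
    linear_combination -r4 + 2 * r3 + d2 - 2 * hT1 - hT0 - d0
  induction n using Nat.strong_induction_on with
  | _ n ih =>
  intro N hN
  rw [Finset.sum_range_succ']
  have hl : lacunaryCoeff p 0 (n + 1) = (if n = 0 then (p : ℚ) else 0)
      - (if n = 1 then 2 * ((p : ℚ) - 1) else 0) + (if n = 2 then (p : ℚ) - 2 else 0) := by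
    simp [lacunaryCoeff]
  rw [hl]
  by_cases hdvd : p ∣ n + 1
  · obtain ⟨q, hq⟩ := hdvd
    obtain ⟨q, rfl⟩ : ∃ q', q = q' + 1 :=
      Nat.exists_eq_succ_of_ne_zero (by rintro rfl; simp at hq)
    have hqn : q < n := by nlinarith
    have hsum : ∑ i ∈ Finset.range N, lacunaryCoeff p (i + 1) (n + 1)
        = ∑ i ∈ Finset.range N, lacunaryCoeff p i (q + 1) := by
      simp only [hq, lacunaryCoeff_succ_mul hp0]
    obtain ⟨N, rfl⟩ : ∃ N', N = N' + 1 := Nat.exists_eq_succ_of_ne_zero (by omega)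
    have ihq := ih q hqn N (by omega)
    have hd1 : (n + 1) / p = q + 1 := by rw [hq, Nat.mul_div_cancel_left _ hp0]
    have hd0 : n / p = q := by
      rw [mul_add, mul_one] at hq
      rw [show n = p * q + (p - 1) by omega, Nat.mul_add_div hp0, Nat.div_eq_of_lt (by omega),
        add_zero]
    have hn2 : 2 ≤ n := by nlinarith
    rw [hsum, mul_add, ← ihq, if_neg (by omega), if_neg (by omega), hstep (n + 1) (by omega), hd1]
    rcases eq_or_ne n 2 with rfl | hn
    · -- Here `p = 3`, and `secondDiff a 2` is an initial value.
      obtain rfl : p = 3 := by nlinarith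
      obtain rfl : q = 0 := by omega
      rw [if_pos rfl, s2, s0]
      norm_num
      ring
    · rw [if_neg hn, hstep n (by omega), hd0]
      ring
  · rw [Finset.sum_eq_zero fun i _ => lacunaryCoeff_succ_of_not_dvd i hdvd]
    have hdiv : (n + 1) / p = n / p := by
      rw [Nat.succ_div, if_neg hdvd, add_zero]
    rcases (show n = 0 ∨ n = 1 ∨ n = 2 ∨ 3 ≤ n by omega) with rfl | rfl | rfl | hn
    · rw [s0, s1]; simp; ring
    · rw [s1, s2]; simp; ring
    · rw [hstep 3 le_rfl, hdiv, Nat.div_eq_of_lt (by omega), s0, s2]; simp; ring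
    · rw [hstep (n + 1) (by omega), hdiv, ← hstep n hn, if_neg (by omega), if_neg (by omega),
        if_neg (by omega)]
      simp

/-! ### The generating function -/

theorem mainTheorem3 (p : ℕ) (hp : p.Prime) (hp3 : 3 ≤ p) :
    Summable (fun i : ℕ => lacunaryTerm p i) ∧
    accessibleGenFun (1 + Polynomial.X) p =
      ((1 - PowerSeries.X) ^ 3)⁻¹ *
        (1 + PowerSeries.C ((p : ℚ) - 3) * PowerSeries.X
          + PowerSeries.C ((p : ℚ) ^ 2 - 3 * p + 3) * PowerSeries.X ^ 2
          + PowerSeries.X ^ 2 * PowerSeries.C (((p : ℚ) - 1) ^ 2 / 2)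
            * ∑' i : ℕ, lacunaryTerm p i) := by
  have : Fact p.Prime := ⟨hp⟩
  have hsum : HasSum (fun i : ℕ => lacunaryTerm p i)
      (PowerSeries.mk fun n => ∑ i ∈ Finset.range (n + 1), lacunaryCoeff p i n) := by
    rw [PowerSeries.WithPiTopology.hasSum_iff_hasSum_coeff]
    intro n
    simp only [coeff_lacunaryTerm, PowerSeries.coeff_mk]
    refine hasSum_sum_of_ne_finset_zero fun i hi => lacunaryCoeff_eq_zero hp.one_lt ?_
    rw [Finset.mem_range] at hi
    omega
  refine ⟨hsum.summable, ?_⟩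
  rw [hsum.tsum_eq]
  set a : ℕ → ℚ := fun n => (accessibleCount (1 + Polynomial.X) p n : ℚ) with ha
  have h0 : a 0 = 1 := by simp [ha, accessibleCount_zero]
  have h1 : a 1 = p := by simp [ha, accessibleCount_one]
  have h2 : a 2 = (p : ℚ) ^ 2 := by simp [ha, accessibleCount_two]
  have hrec : ∀ m, 3 ≤ m → ∑ r ∈ Finset.range p, ∑ d ∈ Finset.range p, a ((m + r + d) / p)
      = a m + 3 * ((p : ℚ) - 1) * (p - 1) + ((p : ℚ) ^ 2 - 1) := by
    intro m hm
    have e := congrArg (Nat.cast : ℕ → ℚ) (sum_accessibleCount_div (p := p) hm)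
    have hp2 : 1 ≤ p ^ 2 := Nat.one_le_pow _ _ hp.pos
    push_cast [Nat.cast_sub hp.one_le, Nat.cast_sub hp2] at e
    exact e
  have key := secondDiff_succ_sub hp3 h0 h1 h2 hrec
  have hc : PowerSeries.constantCoeff ((1 - PowerSeries.X : PowerSeries ℚ) ^ 3) ≠ 0 := by simp
  rw [mul_comm, PowerSeries.eq_mul_inv_iff_mul_eq hc]
  have hA : accessibleGenFun (1 + Polynomial.X) p = PowerSeries.mk a := rfl
  rw [hA, show PowerSeries.mk a * (1 - PowerSeries.X) ^ 3
    = PowerSeries.mk a - PowerSeries.C 3 * (PowerSeries.mk a * PowerSeries.X ^ 1)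
      + PowerSeries.C 3 * (PowerSeries.mk a * PowerSeries.X ^ 2)
      - PowerSeries.mk a * PowerSeries.X ^ 3 by
    rw [show (PowerSeries.C (3 : ℚ)) = 3 from map_ofNat _ 3]; ring,
    mul_assoc (PowerSeries.X ^ 2), mul_comm (PowerSeries.X ^ 2)]
  generalize hc1 : (p : ℚ) - 3 = c1
  generalize hc2 : (p : ℚ) ^ 2 - 3 * p + 3 = c2
  generalize hc3 : ((p : ℚ) - 1) ^ 2 / 2 = c3 at key ⊢
  ext n
  simp only [map_add, map_sub, PowerSeries.coeff_C_mul, PowerSeries.coeff_mul_X_pow',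
    PowerSeries.coeff_mk, PowerSeries.coeff_one, PowerSeries.coeff_X, PowerSeries.coeff_C,
    mul_assoc]
  rcases (show n = 0 ∨ n = 1 ∨ n = 2 ∨ 3 ≤ n by omega) with rfl | rfl | rfl | hn
  · simp [h0]
  · simp [h0, h1, ← hc1]
  · simp [h0, h1, h2, lacunaryCoeff_eq_zero hp.one_lt (le_refl 0), ← hc2]
  · obtain ⟨n, rfl⟩ := Nat.exists_eq_add_of_le' hn
    have e := key n (n + 1) (by omega)
    simp [secondDiff] at e ⊢
    linear_combination e
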